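/- Let $\Bbbk$ be a field and $S=\Bbbk[x_1,\dots,x_n]$, graded by $\deg(x_i)=1$. For a homogeneous ideal $I\subseteq S$ let $\mathrm{HS}(S/I;t)=\sum_{d\ge 0}\dim_{\Bbbk}(S/I)_d\,t^d$ be the Hilbert series of $S/I$. A monomial ideal $J\subseteq S$ is called lexsegment if for every monomial $m\in J$, every monomial $m'$ with $\deg m'=\deg m$ and $m\preceq_{\mathrm{lex}}m'$ also belongs to $J$, where $\preceq_{\mathrm{lex}}$ is the lexicographic order with $x_1\succ x_2\succ\cdots\succ x_n$. For a monomial ideal $J$ let $\mathrm{maxdeg}(J)$ be the maximal degree of a minimal monomial generator of $J$. For a monomial order $\preceq$ and an ideal $I$, a Gröbner basis of $I$ is a finite set $G\subseteq I$ such that the initial terms of the elements of $G$ generate the initial ideal $\mathrm{in}_{\preceq}(I)$; it is reduced if its elements are monic and no monomial occurring in an element $g\in G$ is divisible by $\mathrm{in}_{\preceq}(h)$ for some $h\in G\setminus\{g\}$. (The maximal degree over an empty set is $0$.) Let $I\subseteq S$ be a homogeneous ideal. Then there is a unique lexsegment ideal $J\subseteq S$ with $\mathrm{HS}(S/J;t)=\mathrm{HS}(S/I;t)$.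 Moreover, for every monomial order $\preceq$ on $S$, the ideal $I$ has a unique reduced Gröbner basis with respect to $\preceq$, and the maximal degree $\mathrm{maxGBdeg}_{\preceq}(I)$ of a polynomial in it satisfies $$\mathrm{maxGBdeg}_{\preceq}(I)\le \mathrm{maxdeg}(J).$$ -/

import Mathlib

open MvPolynomial

namespace LexSeg

variable {n : ℕ} {𝕜 : Type*} [Field 𝕜]

/-- Homogeneous ideals of `𝕜[x₁, …, xₙ]` for the standard grading `deg xᵢ = 1`. -/
def IsHomogeneousIdeal (I : Ideal (MvPolynomial (Fin n) 𝕜)) : Prop :=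
  letI : GradedAlgebra (homogeneousSubmodule (Fin n) 𝕜) := MvPolynomial.gradedAlgebra
  I.IsHomogeneous (homogeneousSubmodule (Fin n) 𝕜)

/-- The degree `d` component `(S/I)_d` of the quotient of `S = 𝕜[x₁, …, xₙ]` by `I`:
the image of `S_d` in `S/I`. -/
noncomputable def quotientComponent (I : Ideal (MvPolynomial (Fin n) 𝕜)) (d : ℕ) :
    Submodule 𝕜 (MvPolynomial (Fin n) 𝕜 ⧸ I) :=
  (homogeneousSubmodule (Fin n) 𝕜 d).map (Ideal.Quotient.mkₐ 𝕜 I).toLinearMap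

/-- The Hilbert series `HS(S/I; t) = ∑_d dim (S/I)_d t^d`. Each `(S/I)_d` is finite-dimensional. -/
noncomputable def hilbertSeries (I : Ideal (MvPolynomial (Fin n) 𝕜)) : PowerSeries ℤ :=
  PowerSeries.mk fun d => (Module.finrank 𝕜 (quotientComponent I d) : ℤ)

/-- An ideal generated by monomials. -/
def IsMonomialIdeal (J : Ideal (MvPolynomial (Fin n) 𝕜)) : Prop :=
  ∃ A : Set (Fin n →₀ ℕ), J = Ideal.span ((fun a => monomial a (1 : 𝕜)) '' A)

/-- Lexsegment ideals: monomial ideals that contain, with a monomial `x^a`, every monomial `x^b` of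
the same degree which is larger in the lexicographic order with `x₁ > x₂ > ⋯ > xₙ`. -/
def IsLexsegment (J : Ideal (MvPolynomial (Fin n) 𝕜)) : Prop :=
  IsMonomialIdeal J ∧
    ∀ a b : Fin n →₀ ℕ, monomial a (1 : 𝕜) ∈ J → a.degree = b.degree →
      MonomialOrder.lex.toSyn a ≤ MonomialOrder.lex.toSyn b → monomial b (1 : 𝕜) ∈ J

/-- `J` is a lexsegment ideal with the same Hilbert series as `I`. -/
def IsLexsegmentIdealOf (J I : Ideal (MvPolynomial (Fin n) 𝕜)) : Prop :=
  IsLexsegment J ∧ hilbertSeries J = hilbertSeries I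

/-- The initial ideal of `I`, generated by the initial terms of the elements of `I`. -/
noncomputable def initialIdeal (m : MonomialOrder (Fin n)) (I : Ideal (MvPolynomial (Fin n) 𝕜)) :
    Ideal (MvPolynomial (Fin n) 𝕜) :=
  Ideal.span (m.leadingTerm '' (I : Set (MvPolynomial (Fin n) 𝕜)))

/-- A finite set `G ⊆ I` is a Gröbner basis of `I` if the initial terms of its elements generate the
initial ideal of `I`. -/
def IsGroebnerBasis (m : MonomialOrder (Fin n)) (I : Ideal (MvPolynomial (Fin n) 𝕜))
    (G : Finset (MvPolynomial (Fin n) 𝕜)) : Prop :=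
  (∀ g ∈ G, g ∈ I) ∧
    initialIdeal m I = Ideal.span (m.leadingTerm '' (G : Set (MvPolynomial (Fin n) 𝕜)))

/-- A Gröbner basis is reduced if its elements are monic and no monomial occurring in one element is
divisible by the initial monomial of another one (divisibility of monomials is `≤` of exponents). -/
def IsReducedGroebnerBasis (m : MonomialOrder (Fin n)) (I : Ideal (MvPolynomial (Fin n) 𝕜))
    (G : Finset (MvPolynomial (Fin n) 𝕜)) : Prop :=
  IsGroebnerBasis m I G ∧ (∀ g ∈ G, m.Monic g) ∧
    ∀ g ∈ G, ∀ h ∈ G, h ≠ g → ∀ a ∈ g.support, ¬ m.degree h ≤ a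

/-- The exponents of the minimal generators of a monomial ideal `J`: the monomials in `J` that are
minimal for divisibility. -/
def minimalGenerators (J : Ideal (MvPolynomial (Fin n) 𝕜)) : Set (Fin n →₀ ℕ) :=
  {a | Minimal (fun b : Fin n →₀ ℕ => monomial b (1 : 𝕜) ∈ J) a}

theorem minimalGenerators_finite (J : Ideal (MvPolynomial (Fin n) 𝕜)) :
    (minimalGenerators J).Finite :=
  WellQuasiOrderedLE.finite_of_isAntichain (setOfPred_minimal_antichain _)

/-- The maximal degree of a minimal generator of a monomial ideal (`0` for the zero ideal). -/
noncomputable def maxdeg (J : Ideal (MvPolynomial (Fin n) 𝕜)) : ℕ :=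
  (minimalGenerators_finite J).toFinset.sup fun a => a.degree

/-- The maximal degree of a polynomial in a finite set (`0` for the empty set). -/
def maxTotalDegree (G : Finset (MvPolynomial (Fin n) 𝕜)) : ℕ :=
  G.sup fun g => g.totalDegree

end LexSeg

/-!
Let `E` be the set of exponents of initial monomials of `I`, for some monomial order. Division with
remainder shows that the monomials outside `E` form a basis of `S/I`, in each degree if `I` is
homogeneous (`finrank_quotientComponent_add_card`), so the Hilbert series of `S/I` records exactly
how many elements `E` has in each degree, whatever the order.

The combinatorial heart is Macaulay's theorem (`IsLexSet.card_shadow_le`): among the sets of at least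
`k` monomials of degree `d`, the `k` lexicographically largest monomials have the smallest shadow,
the shadow being the set of products with a variable. A shifting argument
(`exists_isStronglyStable`) reduces this to strongly stable sets `A`. For these,
`|shadow A| = |shadow A₀| + |A|`, where `A₀` is the part free of the last variable and its shadow is
taken in the remaining variables (`IsStronglyStable.card_shadow`). By induction on the number of
variables it remains to see `|L₀| ≤ |A₀|` for the lexicographic set `L`: one replaces the slices
of `A` along the last variable by lexicographic ones and observes that, if `A₀` were too small, all
of them would be contained in the slices of `L`, the first one strictly.

Macaulay's theorem is used twice. The lexicographic sets with as many elements as `E` in each degree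
are closed under multiplication by variables, hence span the lexsegment ideal `J`
(`exists_isLexsegmentIdealOf`); since it is determined by the number of its monomials in each degree,
it is unique. And the shadow of `J` in degree `d` being no larger than that of `E`, a new generator
of `E` in degree `d + 1` forces a new generator of `J` there (`degree_le_maxdeg`).

Finally, the reduced Gröbner basis consists of the polynomials `xᵃ - r`, where `a` is minimal in `E`
and `r` is the remainder of `xᵃ` (`isReducedGroebnerBasis_iff`); if `I` is homogeneous, so are these,
and their degrees are those of the minimal elements of `E`.
-/

namespace LexSeg

section Combinatorics

open Finset Finsupp

variable {n : ℕ}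

/-! ### Sets of monomials, shadows and slices -/

/-- Exponents of the monomials of degree `d` in the variables indexed by `V`. -/
abbrev monomialsOn (V : Finset (Fin n)) (d : ℕ) : Finset (Fin n →₀ ℕ) :=
  V.finsuppAntidiag d

/-- The products of the monomials in `A` with the variables indexed by `V`. -/
noncomputable def shadow (V : Finset (Fin n)) (A : Finset (Fin n →₀ ℕ)) : Finset (Fin n →₀ ℕ) :=
  A.biUnion fun m => V.image fun i => m + single i 1

/-- The set `L` of monomials of degree `d` in the variables of `V` contains, with a monomial, every
lexicographically larger one. -/
def IsLexSet (V : Finset (Fin n)) (d : ℕ) (L : Finset (Fin n →₀ ℕ)) : Prop :=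
  L ⊆ monomialsOn V d ∧ ∀ a ∈ L, ∀ b ∈ monomialsOn V d, toLex a ≤ toLex b → b ∈ L

/-- Strong stability: replacing a variable of a monomial in `A` by one of smaller index (both taken
from `V`) gives a monomial in `A`. -/
def IsStronglyStable (V : Finset (Fin n)) (A : Finset (Fin n →₀ ℕ)) : Prop :=
  ∀ m : Fin n →₀ ℕ, ∀ i ∈ V, ∀ j ∈ V, i < j → m + single j 1 ∈ A → m + single i 1 ∈ A

/-- The monomials free of `xₐ` whose product with `xₐ ^ j` lies in `A`. -/
noncomputable def slice (a : Fin n) (j : ℕ) (A : Finset (Fin n →₀ ℕ)) : Finset (Fin n →₀ ℕ) :=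
  (A.filter fun m => m a = j).image (Finsupp.erase a)

variable {V : Finset (Fin n)} {d : ℕ} {A L : Finset (Fin n →₀ ℕ)}

theorem mem_monomialsOn {m : Fin n →₀ ℕ} :
    m ∈ monomialsOn V d ↔ m.degree = d ∧ ∀ i ∉ V, m i = 0 := by
  have key : m.support ⊆ V ↔ ∀ i ∉ V, m i = 0 := by
    refine ⟨fun h i hi => ?_, fun h i hi => ?_⟩
    · by_contra h0
      exact hi (h (Finsupp.mem_support_iff.2 h0))
    · by_contra h0
      exact Finsupp.mem_support_iff.1 hi (h i h0)
  rw [monomialsOn, mem_finsuppAntidiag, ← key]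
  refine and_congr_left fun h => ?_
  rw [degree_apply, Finset.sum_subset h]
  simp

theorem add_single_mem_monomialsOn {m : Fin n →₀ ℕ} {i : Fin n} (hm : m ∈ monomialsOn V d)
    (hi : i ∈ V) (k : ℕ) : m + single i k ∈ monomialsOn V (d + k) := by
  rw [mem_monomialsOn] at hm ⊢
  refine ⟨by simp [hm.1], fun q hq => ?_⟩
  have : i ≠ q := by rintro rfl; exact hq hi
  simp [hm.2 q hq, this]

theorem mem_shadow {b : Fin n →₀ ℕ} :
    b ∈ shadow V A ↔ ∃ m ∈ A, ∃ i ∈ V, m + single i 1 = b := by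
  simp [shadow]

theorem add_single_mem_shadow {m : Fin n →₀ ℕ} {i : Fin n} (hm : m ∈ A) (hi : i ∈ V) :
    m + single i 1 ∈ shadow V A :=
  mem_shadow.2 ⟨m, hm, i, hi, rfl⟩

theorem shadow_subset_monomialsOn (hA : A ⊆ monomialsOn V d) :
    shadow V A ⊆ monomialsOn V (d + 1) := by
  intro b hb
  obtain ⟨m, hm, i, hi, rfl⟩ := mem_shadow.1 hb
  exact add_single_mem_monomialsOn (hA hm) hi 1

theorem mem_slice {a : Fin n} {j : ℕ} {x : Fin n →₀ ℕ} :
    x ∈ slice a j A ↔ x a = 0 ∧ x + single a j ∈ A := by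
  simp only [slice, mem_image, mem_filter]
  constructor
  · rintro ⟨m, ⟨hm, rfl⟩, rfl⟩
    refine ⟨by simp, ?_⟩
    rwa [Finsupp.erase_add_single]
  · rintro ⟨h0, h⟩
    refine ⟨_, ⟨h, by simp [h0]⟩, ?_⟩
    ext q
    by_cases hq : q = a
    · subst hq; simp [h0]
    · simp [Finsupp.erase_ne hq]

theorem card_slice (a : Fin n) (j : ℕ) (A : Finset (Fin n →₀ ℕ)) :
    (slice a j A).card = (A.filter fun m => m a = j).card := by
  refine card_image_of_injOn fun x hx y hy hxy => ?_
  have hx' : x a = j := (mem_filter.1 hx).2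
  have hy' : y a = j := (mem_filter.1 hy).2
  rw [← Finsupp.erase_add_single a x, ← Finsupp.erase_add_single a y, hx', hy']
  exact congrArg (· + single a j) hxy

theorem sum_card_slice (a : Fin n) (hA : A ⊆ monomialsOn V d) :
    ∑ j ∈ range (d + 1), (slice a j A).card = A.card := by
  simp only [card_slice]
  refine (card_eq_sum_card_fiberwise fun m hm => ?_).symm
  have h := (mem_monomialsOn.1 (hA hm)).1
  have : m a ≤ d := h ▸ Finsupp.le_degree a m
  simpa using Nat.lt_succ_of_le this

theorem slice_subset_monomialsOn {a : Fin n} {s : Finset (Fin n)} {j : ℕ}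
    (hA : A ⊆ monomialsOn (insert a s) d) : slice a j A ⊆ monomialsOn s (d - j) := by
  intro x hx
  obtain ⟨h0, hx⟩ := mem_slice.1 hx
  obtain ⟨hd, hs⟩ := mem_monomialsOn.1 (hA hx)
  rw [mem_monomialsOn]
  refine ⟨?_, fun i hi => ?_⟩
  · simp only [map_add, degree_single] at hd
    omega
  · by_cases hia : i = a
    · rw [hia, h0]
    · have := hs i (by simp [hi, hia])
      simp only [Finsupp.add_apply] at this
      omega

theorem eq_empty_slice {a : Fin n} {j : ℕ} (hA : A ⊆ monomialsOn V d) (hj : d < j) :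
    slice a j A = ∅ := by
  refine eq_empty_of_forall_notMem fun x hx => ?_
  have h := (mem_monomialsOn.1 (hA (mem_slice.1 hx).2)).1
  simp only [map_add, degree_single] at h
  omega

/-! ### Strongly stable sets -/

protected theorem IsStronglyStable.slice {a : Fin n} {s : Finset (Fin n)} (ha : a ∉ s) (j : ℕ)
    (hA : IsStronglyStable (insert a s) A) : IsStronglyStable s (slice a j A) := by
  intro m i hi k hk hik h
  rw [mem_slice] at h ⊢
  have hia : i ≠ a := by rintro rfl; exact ha hi
  have hka : k ≠ a := by rintro rfl; exact ha hk
  refine ⟨by simpa [hia, hka] using h.1, ?_⟩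
  rw [add_right_comm] at h ⊢
  exact hA _ i (mem_insert_of_mem hi) k (mem_insert_of_mem hk) hik h.2

/-- Multiplying a monomial of the `(j + 1)`-st slice by a variable of smaller index moves it to the
`j`-th slice. -/
theorem IsStronglyStable.shadow_slice_subset {a : Fin n} {s : Finset (Fin n)}
    (ha : ∀ x ∈ s, x < a) (j : ℕ) (hA : IsStronglyStable (insert a s) A) :
    shadow s (slice a (j + 1) A) ⊆ slice a j A := by
  intro b hb
  obtain ⟨m, hm, i, hi, rfl⟩ := mem_shadow.1 hb
  rw [mem_slice] at hm ⊢
  refine ⟨by simp [hm.1, (ha i hi).ne], ?_⟩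
  rw [add_right_comm]
  refine hA _ i (mem_insert_of_mem hi) a (mem_insert_self _ _) (ha i hi) ?_
  rw [add_assoc, ← single_add]
  exact hm.2

/-- The shadow of a strongly stable set consists of the products with the last variable and of the
shadow of the part free of that variable. -/
theorem IsStronglyStable.card_shadow {a : Fin n} {s : Finset (Fin n)}
    (ha : ∀ x ∈ s, x < a) (hA : IsStronglyStable (insert a s) A) :
    (shadow (insert a s) A).card = (shadow s (slice a 0 A)).card + A.card := by
  have has : a ∉ s := fun h => lt_irrefl _ (ha a h)
  have hinj : (A.image (· + single a 1)).card = A.card :=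
    card_image_of_injective _ (add_left_injective _)
  rw [← hinj, ← card_union_of_disjoint]
  · congr 1
    ext b
    simp only [mem_union, mem_image]
    constructor
    · intro hb
      obtain ⟨m, hm, i, hi, rfl⟩ := mem_shadow.1 hb
      rcases mem_insert.1 hi with rfl | hi
      · exact Or.inr ⟨m, hm, rfl⟩
      · by_cases h0 : m a = 0
        · exact Or.inl (add_single_mem_shadow (mem_slice.2 ⟨h0, by simpa using hm⟩) hi)
        · right
          have hma : m - single a 1 + single a 1 = m :=
            tsub_add_cancel_of_le (by simpa using Nat.one_le_iff_ne_zero.2 h0)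
          refine ⟨m - single a 1 + single i 1, ?_, by rw [add_right_comm, hma]⟩
          exact hA _ i (mem_insert_of_mem hi) a (mem_insert_self _ _) (ha i hi) (by rwa [hma])
    · rintro (hb | ⟨m, hm, rfl⟩)
      · obtain ⟨m, hm, i, hi, rfl⟩ := mem_shadow.1 hb
        have := (mem_slice.1 hm).2
        rw [single_zero, add_zero] at this
        exact add_single_mem_shadow this (mem_insert_of_mem hi)
      · exact add_single_mem_shadow hm (mem_insert_self _ _)
  · rw [Finset.disjoint_left]
    intro b hb hb'
    obtain ⟨m, hm, i, hi, rfl⟩ := mem_shadow.1 hb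
    obtain ⟨m', -, h⟩ := mem_image.1 hb'
    have h1 := DFunLike.congr_fun h a
    have hia : i ≠ a := (ha i hi).ne
    simp [(mem_slice.1 hm).1, hia] at h1

/-! ### Lexicographic sets -/

theorem toLex_lt_of_le_of_lt {a b : Fin n →₀ ℕ} {r : Fin n} (h : ∀ q < r, a q ≤ b q)
    (hr : a r < b r) : toLex a < toLex b := by
  by_contra hlt
  rcases (not_lt.1 hlt).eq_or_lt with h1 | h1
  · rw [toLex_inj.1 h1] at hr
    exact lt_irrefl _ hr
  · obtain ⟨i, hi, hi'⟩ := Finsupp.Lex.lt_iff.1 h1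
    simp only [ofLex_toLex] at hi hi'
    rcases lt_trichotomy i r with hir | rfl | hir
    · exact absurd (h i hir) (not_le.2 hi')
    · exact lt_asymm hr hi'
    · exact hr.ne (hi r hir).symm

theorem eq_of_le_of_degree_eq {a b : Fin n →₀ ℕ} (h : a ≤ b) (hd : a.degree = b.degree) :
    a = b := by
  rw [degree_eq_sum, degree_eq_sum] at hd
  ext i
  exact (Finset.sum_eq_sum_iff_of_le fun i _ => h i).1 hd i (mem_univ i)

namespace IsLexSet

theorem isStronglyStable (hL : IsLexSet V d L) : IsStronglyStable V L := by
  intro m i hi j hj hij h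
  refine hL.2 _ h _ ?_ ?_
  · have hm := mem_monomialsOn.1 (hL.1 h)
    rw [mem_monomialsOn]
    refine ⟨by simpa using hm.1, fun q hq => ?_⟩
    have h1 : i ≠ q := by rintro rfl; exact hq hi
    have h2 := hm.2 q hq
    simp only [Finsupp.add_apply, Nat.add_eq_zero_iff] at h2
    simp [h1, h2.1]
  · refine (toLex_lt_of_le_of_lt (r := i) (fun q hq => ?_) ?_).le
    · simp [(hq.trans hij).ne']
    · simp [hij.ne']

theorem subset_of_card_le {L' : Finset (Fin n →₀ ℕ)} (hL : IsLexSet V d L)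
    (hL' : IsLexSet V d L') (h : L.card ≤ L'.card) : L ⊆ L' := by
  by_contra hsub
  obtain ⟨x, hx, hx'⟩ := Finset.not_subset.1 hsub
  have h1 : L' ⊆ L := fun y hy => by
    rcases le_total (toLex x) (toLex y) with hxy | hxy
    · exact hL.2 x hx y (hL'.1 hy) hxy
    · exact absurd (hL'.2 y hy x (hL.1 hx) hxy) hx'
  exact hx' (eq_of_subset_of_card_le h1 h ▸ hx)

protected theorem slice {a : Fin n} {s : Finset (Fin n)} (ha : a ∉ s)
    (hL : IsLexSet (insert a s) d L) : IsLexSet s d (slice a 0 L) := by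
  refine ⟨slice_subset_monomialsOn hL.1, fun x hx y hy hxy => ?_⟩
  rw [mem_slice, single_zero, add_zero] at hx ⊢
  have hy' := mem_monomialsOn.1 hy
  exact ⟨hy'.2 a ha, hL.2 x hx.2 y
    (mem_monomialsOn.2 ⟨hy'.1, fun i hi => hy'.2 i fun h => hi (mem_insert_of_mem h)⟩) hxy⟩

/-- The shadow of a lexicographic set is lexicographic: a monomial `b` which is at least
`m xᵢ` is divisible by its last variable, and the quotient is at least `m`. -/
protected theorem shadow (hL : IsLexSet V d L) : IsLexSet V (d + 1) (shadow V L) := by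
  refine ⟨shadow_subset_monomialsOn hL.1, fun x hx b hb hxb => ?_⟩
  obtain ⟨m, hm, i, hi, rfl⟩ := mem_shadow.1 hx
  obtain ⟨hbd, hbs⟩ := mem_monomialsOn.1 hb
  obtain ⟨hmd, -⟩ := mem_monomialsOn.1 (hL.1 hm)
  have hne : b.support.Nonempty := by
    rw [Finsupp.support_nonempty_iff]
    rintro rfl
    simp at hbd
  obtain ⟨k, hk0, hk⟩ : ∃ k, b k ≠ 0 ∧ ∀ q, b q ≠ 0 → q ≤ k :=
    ⟨b.support.max' hne, Finsupp.mem_support_iff.1 (max'_mem _ hne),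
      fun q hq => le_max' _ _ (Finsupp.mem_support_iff.2 hq)⟩
  have hkV : k ∈ V := by
    by_contra h
    exact hk0 (hbs k h)
  obtain ⟨c, rfl⟩ : ∃ c, b = c + single k 1 :=
    ⟨b - single k 1, (tsub_add_cancel_of_le (by simpa using Nat.one_le_iff_ne_zero.2 hk0)).symm⟩
  have hcd : c.degree = d := by simpa using hbd
  refine add_single_mem_shadow (hL.2 m hm c ?_ ?_) hkV
  · refine mem_monomialsOn.2 ⟨hcd, fun q hq => ?_⟩
    have := hbs q hq
    simp only [Finsupp.add_apply, Nat.add_eq_zero_iff] at this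
    exact this.1
  · by_contra hlt
    obtain ⟨r, hr, hr'⟩ := Finsupp.Lex.lt_iff.1 (not_le.1 hlt)
    simp only [ofLex_toLex] at hr hr'
    -- since `c` and `m` have the same degree, `c` exceeds `m` somewhere after `r`, so `r < k`
    have hrk : r < k := by
      by_contra hkr
      have hle : c ≤ m := fun q => by
        rcases lt_trichotomy q r with h | rfl | h
        · exact (hr q h).le
        · exact hr'.le
        · have : ¬ (c + single k 1 : Fin n →₀ ℕ) q ≠ 0 := fun h0 => hkr (h.trans_le (hk q h0))
          simp only [Finsupp.add_apply, not_not, Nat.add_eq_zero_iff] at this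
          simp [this.1]
      exact hr'.ne (DFunLike.congr_fun (eq_of_le_of_degree_eq hle (hcd.trans hmd.symm)) r)
    refine absurd hxb (not_le.2 (toLex_lt_of_le_of_lt (r := r) (fun q hq => ?_) ?_))
    · simp [hr q hq, (hq.trans hrk).ne']
    · simp only [Finsupp.add_apply, single_eq_of_ne hrk.ne, add_zero]
      exact hr'.trans_le (Nat.le_add_right _ _)

end IsLexSet

theorem exists_isLexSet_card (V : Finset (Fin n)) (d : ℕ) {k : ℕ}
    (hk : k ≤ (monomialsOn V d).card) : ∃ L, IsLexSet V d L ∧ L.card = k := by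
  induction k with
  | zero => exact ⟨∅, ⟨by simp, by simp⟩, rfl⟩
  | succ k ih =>
    obtain ⟨L, hL, rfl⟩ := ih (Nat.le_of_succ_le hk)
    have hne : (monomialsOn V d \ L).Nonempty := by
      rw [← card_pos, card_sdiff_of_subset hL.1]
      omega
    obtain ⟨x, hx, hmax⟩ := exists_max_image _ (fun m => toLex m) hne
    rw [mem_sdiff] at hx
    refine ⟨insert x L, ⟨insert_subset hx.1 hL.1, fun y hy b hb hyb => ?_⟩,
      card_insert_of_notMem hx.2⟩
    by_cases hbL : b ∈ L
    · exact mem_insert_of_mem hbL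
    rcases mem_insert.1 hy with rfl | hy
    · have := le_antisymm (hmax b (mem_sdiff.2 ⟨hb, hbL⟩)) hyb
      rw [toLex_inj.1 this]
      exact mem_insert_self _ _
    · exact absurd (hL.2 y hy b hb hyb) hbL

/-! ### Macaulay's inequality for strongly stable sets -/

/-- Replacing the last variable `a` of `x xₐ ^ j` by the variable `b` just before it keeps the
monomial below `u`, if `u` is free of `a` and of the same degree. -/
theorem toLex_add_single_le {s : Finset (Fin n)} {x u : Fin n →₀ ℕ} {a b : Fin n} {j : ℕ}
    (hb : ∀ i ∈ s, i ≤ b) (hbs : b ∈ s) (ha : ∀ i ∈ s, i < a) (hx : ∀ i ∉ s, x i = 0)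
    (hu : ∀ i ∉ s, u i = 0) (hd : (x + single a j).degree = u.degree)
    (hlt : toLex (x + single a j) < toLex u) : toLex (x + single b j) ≤ toLex u := by
  obtain ⟨i, hi, hi'⟩ := Finsupp.Lex.lt_iff.1 hlt
  simp only [ofLex_toLex] at hi hi'
  have his : i ∈ s := by
    by_contra h
    rw [hu i h] at hi'
    exact Nat.not_lt_zero _ hi'
  have hval : ∀ q < b, (x + single b j) q = (x + single a j) q := fun q hq => by
    simp [hq.ne', (hq.trans (ha b hbs)).ne']
  rcases (hb i his).lt_or_eq with hib | rfl
  · refine (toLex_lt_of_le_of_lt (r := i) (fun q hq => ?_) ?_).le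
    · rw [hval q (hq.trans hib), hi q hq]
    · rwa [hval i hib]
  -- the two monomials agree outside the variable `b`, and have the same degree
  · have hagree : ∀ q ≠ i, (x + single i j) q = u q := fun q hq => by
      rcases hq.lt_or_gt with h | h
      · rw [hval q h, hi q h]
      · have hqs : q ∉ s := fun hqs => absurd (hb q hqs) (not_le.2 h)
        simp [hx q hqs, hu q hqs, h.ne]
    have hd' : (x + single i j).degree = u.degree := by simpa using hd
    have : x + single i j = u := by
      rcases le_total ((x + single i j) i) (u i) with h | h
      · refine eq_of_le_of_degree_eq (fun q => ?_) hd'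
        by_cases hq : q = i
        · exact hq ▸ h
        · exact (hagree q hq).le
      · refine (eq_of_le_of_degree_eq (fun q => ?_) hd'.symm).symm
        by_cases hq : q = i
        · exact hq ▸ h
        · exact (hagree q hq).ge
    rw [this]

/-- Macaulay's inequality for strongly stable sets. -/
theorem IsStronglyStable.card_shadow_le (V : Finset (Fin n)) :
    ∀ {d : ℕ} {A L : Finset (Fin n →₀ ℕ)}, A ⊆ monomialsOn V d → IsStronglyStable V A →
      IsLexSet V d L → L.card ≤ A.card → (shadow V L).card ≤ (shadow V A).card := by
  induction V using Finset.induction_on_max with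
  | empty =>
    intro d A L _ _ _ _
    have h : shadow ∅ L = ∅ := eq_empty_of_forall_notMem fun b hb => by
      simp [mem_shadow] at hb
    simp [h]
  | insert a s ha ih =>
    intro d A L hAV hA hL hcard
    have has : a ∉ s := fun h => lt_irrefl _ (ha a h)
    rw [hA.card_shadow ha, hL.isStronglyStable.card_shadow ha]
    refine Nat.add_le_add (ih (slice_subset_monomialsOn hAV) (hA.slice has 0) (hL.slice has) ?_)
      hcard
    by_contra hlt
    rw [not_le] at hlt
    have hex : ∀ j, ∃ C, IsLexSet s (d - j) C ∧ C.card = (slice a j A).card := fun j =>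
      exists_isLexSet_card s (d - j) (card_le_card (slice_subset_monomialsOn hAV))
    choose C hC hCcard using hex
    have hstep : ∀ j < d, shadow s (C (j + 1)) ⊆ C j := fun j hj => by
      have h1 := (hC (j + 1)).shadow
      rw [show d - (j + 1) + 1 = d - j by omega] at h1
      refine h1.subset_of_card_le (hC j) ?_
      refine (ih (slice_subset_monomialsOn hAV) (hA.slice has (j + 1)) (hC (j + 1))
        (hCcard _).le).trans ?_
      rw [hCcard]
      exact card_le_card (hA.shadow_slice_subset ha j)
    have hiter : ∀ b ∈ s, ∀ j ≤ d, ∀ x ∈ C j, x + single b j ∈ C 0 := by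
      intro b hb j
      induction j with
      | zero => intro _ x hx; simpa using hx
      | succ j ihj =>
        intro hj x hx
        have := ihj (Nat.le_of_succ_le hj) _ (hstep j hj (add_single_mem_shadow hx hb))
        rwa [add_assoc, ← single_add, add_comm 1 j] at this
    obtain ⟨u, huL, huC⟩ : ∃ u ∈ slice a 0 L, u ∉ C 0 := by
      refine Finset.not_subset.1 fun h => ?_
      have := card_le_card h
      rw [hCcard] at this
      omega
    have hus := mem_monomialsOn.1 ((hL.slice has).1 huL)
    have huL' : u ∈ L := by simpa using (mem_slice.1 huL).2
    have hsub : ∀ j, C j ⊆ slice a j L := by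
      intro j x hx
      have hjd : j ≤ d := by
        by_contra hj
        have := hCcard j
        rw [eq_empty_slice hAV (not_le.1 hj), card_empty, card_eq_zero] at this
        rw [this] at hx
        exact notMem_empty _ hx
      have hxs := mem_monomialsOn.1 ((hC j).1 hx)
      have hxd : (x + single a j).degree = d := by
        simp only [map_add, degree_single, hxs.1]
        omega
      rw [mem_slice]
      refine ⟨hxs.2 a has, hL.2 u huL' _ ?_ ?_⟩
      · refine mem_monomialsOn.2 ⟨hxd, fun i hi => ?_⟩
        rw [mem_insert, not_or] at hi
        simp [hxs.2 i hi.2, Ne.symm hi.1]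
      · by_contra hlt'
        rw [not_le] at hlt'
        have hne : s.Nonempty := by
          obtain ⟨i, -, hi'⟩ := Finsupp.Lex.lt_iff.1 hlt'
          refine ⟨i, ?_⟩
          by_contra h
          simp only [ofLex_toLex, hus.2 i h] at hi'
          exact Nat.not_lt_zero _ hi'
        have hb := max'_mem s hne
        refine huC ((hC 0).2 _ (hiter _ hb j hjd x hx) u (mem_monomialsOn.2 hus) ?_)
        exact toLex_add_single_le (fun i hi => le_max' s i hi) hb ha hxs.2 hus.2
          (hxd.trans hus.1.symm) hlt'
    have hlt'' : A.card < L.card := by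
      rw [← sum_card_slice a hAV, ← sum_card_slice a hL.1]
      refine sum_lt_sum (fun j _ => ?_) ⟨0, by simp, hlt⟩
      rw [← hCcard]
      exact card_le_card (hsub j)
    omega

/-! ### Shifting to a strongly stable set -/

/-- The monomial obtained from `m` by replacing every `xⱼ` with `xᵢ`. Its fibres are the sets of
monomials that differ only in how a given power is distributed between `xᵢ` and `xⱼ`. -/
noncomputable def merge (i j : Fin n) (m : Fin n →₀ ℕ) : Fin n →₀ ℕ :=
  m.erase j + single i (m j)

/-- Within each fibre of `merge i j`, the set `A` is replaced with equally many monomials, those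
with the smallest exponents of `xⱼ`. -/
noncomputable def shift (V : Finset (Fin n)) (d : ℕ) (i j : Fin n) (A : Finset (Fin n →₀ ℕ)) :
    Finset (Fin n →₀ ℕ) :=
  (monomialsOn V d).filter fun m => m j < (A.filter fun x => merge i j x = merge i j m).card

theorem merge_add (i j : Fin n) (x y : Fin n →₀ ℕ) :
    merge i j (x + y) = merge i j x + merge i j y := by
  simp only [merge, Finsupp.erase_add, Finsupp.add_apply, single_add]
  exact add_add_add_comm _ _ _ _

theorem merge_single_of_ne {i j k : Fin n} (hk : k ≠ j) :
    merge i j (single k 1) = single k 1 := by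
  simp [merge, Finsupp.erase_single_ne hk.symm, hk]

theorem merge_single_self (i j : Fin n) (t : ℕ) : merge i j (single j t) = single i t := by
  simp [merge]

theorem eq_of_merge_eq {i j : Fin n} {x y : Fin n →₀ ℕ}
    (h : merge i j x = merge i j y) (hj : x j = y j) : x = y := by
  unfold merge at h
  rw [hj] at h
  rw [← Finsupp.erase_add_single j x, ← Finsupp.erase_add_single j y, add_right_cancel h, hj]

theorem apply_le_merge {i j : Fin n} (m : Fin n →₀ ℕ) : m j ≤ merge i j m i := by
  simp [merge]

theorem injOn_apply_fiber (i j : Fin n) (κ : Fin n →₀ ℕ) (A : Finset (Fin n →₀ ℕ)) :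
    Set.InjOn (fun x : Fin n →₀ ℕ => x j) (A.filter fun x => merge i j x = κ) :=
  fun _ hx _ hy h => eq_of_merge_eq ((mem_filter.1 hx).2.trans (mem_filter.1 hy).2.symm) h

theorem exists_mem_fiber {i j : Fin n} (hij : i ≠ j) (hi : i ∈ V) (hj : j ∈ V)
    {m : Fin n →₀ ℕ} (hm : m ∈ monomialsOn V d) {t : ℕ} (ht : t ≤ merge i j m i) :
    ∃ x ∈ monomialsOn V d, merge i j x = merge i j m ∧ x j = t := by
  obtain ⟨hmd, hms⟩ := mem_monomialsOn.1 hm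
  have hle : single i t ≤ merge i j m := by simpa using ht
  obtain ⟨c, hc⟩ : ∃ c, merge i j m = c + single i t := ⟨_, (tsub_add_cancel_of_le hle).symm⟩
  have hdeg : (merge i j m).degree = d := by
    rw [← hmd, merge, map_add, degree_single]
    conv_rhs => rw [← Finsupp.erase_add_single j m, map_add, degree_single]
  have hcj : c j = 0 := by
    have := DFunLike.congr_fun hc j
    simpa [merge, hij] using this.symm
  refine ⟨c + single j t, mem_monomialsOn.2 ⟨?_, fun q hq => ?_⟩, ?_, by simp [hcj]⟩
  · rw [← hdeg, hc]
    simp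
  · have h1 : i ≠ q := by rintro rfl; exact hq hi
    have h2 : j ≠ q := by rintro rfl; exact hq hj
    have := DFunLike.congr_fun hc q
    simp only [merge, Finsupp.add_apply, Finsupp.erase_ne h2.symm, hms q hq,
      single_eq_of_ne h1.symm] at this
    simp only [Finsupp.add_apply, single_eq_of_ne h2.symm]
    omega
  · rw [merge_add, merge_single_self, hc]
    congr 1
    simp [merge, hcj, Finsupp.erase_of_notMem_support]

theorem card_fiber_le {i j : Fin n} (κ : Fin n →₀ ℕ) :
    (A.filter fun x => merge i j x = κ).card ≤ κ i + 1 := by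
  rw [← card_range (κ i + 1)]
  refine card_le_card_of_injOn (fun x => x j) (fun x hx => ?_) (injOn_apply_fiber i j κ A)
  have h : merge i j x = κ := (mem_filter.1 hx).2
  have := apply_le_merge (i := i) (j := j) x
  rw [h] at this
  simpa using Nat.lt_succ_of_le this

/-- In each fibre the exponents of `xⱼ` occurring in `shift V d i j A` form an initial segment. -/
theorem image_fiber_shift {i j : Fin n} (hij : i ≠ j) (hi : i ∈ V) (hj : j ∈ V)
    (hA : A ⊆ monomialsOn V d) (κ : Fin n →₀ ℕ) :
    ((shift V d i j A).filter fun x => merge i j x = κ).image (fun x => x j) =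
      range (A.filter fun x => merge i j x = κ).card := by
  ext t
  simp only [mem_image, mem_filter, shift, mem_range]
  constructor
  · rintro ⟨x, ⟨⟨-, hx⟩, rfl⟩, rfl⟩
    exact hx
  · intro ht
    obtain ⟨m, hm⟩ := card_pos.1 (Nat.zero_lt_of_lt ht)
    obtain ⟨hmA, rfl⟩ := mem_filter.1 hm
    obtain ⟨x, hxV, hx, rfl⟩ := exists_mem_fiber hij hi hj (hA hmA)
      (Nat.le_of_lt_succ (ht.trans_le (card_fiber_le _)))
    exact ⟨x, ⟨⟨hxV, by rwa [hx]⟩, hx⟩, rfl⟩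

theorem card_fiber_shift {i j : Fin n} (hij : i ≠ j) (hi : i ∈ V) (hj : j ∈ V)
    (hA : A ⊆ monomialsOn V d) (κ : Fin n →₀ ℕ) :
    ((shift V d i j A).filter fun x => merge i j x = κ).card =
      (A.filter fun x => merge i j x = κ).card := by
  rw [← card_image_of_injOn (injOn_apply_fiber i j κ _), image_fiber_shift hij hi hj hA,
    card_range]

theorem shift_subset (i j : Fin n) : shift V d i j A ⊆ monomialsOn V d :=
  filter_subset _ _

theorem card_shift {i j : Fin n} (hij : i ≠ j) (hi : i ∈ V) (hj : j ∈ V)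
    (hA : A ⊆ monomialsOn V d) : (shift V d i j A).card = A.card := by
  rw [card_eq_sum_card_fiberwise (f := merge i j) (t := (monomialsOn V d).image (merge i j))
      fun m hm => mem_image_of_mem _ (hA hm),
    card_eq_sum_card_fiberwise (f := merge i j) (t := (monomialsOn V d).image (merge i j))
      fun m hm => mem_image_of_mem _ (shift_subset i j hm)]
  exact sum_congr rfl fun κ _ => card_fiber_shift hij hi hj hA κ

/-- Multiplying by `xⱼ` the whole fibre, and by `xᵢ` the member of least exponent of `xⱼ`, produces
one more monomial than there are in the fibre. -/
theorem card_fiber_lt_card_fiber_shadow {i j : Fin n} (hij : i ≠ j) (hi : i ∈ V) (hj : j ∈ V)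
    (κ : Fin n →₀ ℕ) (hne : (A.filter fun x => merge i j x = κ).Nonempty) :
    (A.filter fun x => merge i j x = κ).card <
      ((shadow V A).filter fun x => merge i j x = κ + single i 1).card := by
  obtain ⟨x, hx, hmin⟩ := exists_min_image _ (fun x => x j) hne
  have hnot : x + single i 1 ∉ (A.filter fun x => merge i j x = κ).image (· + single j 1) := by
    intro h
    obtain ⟨y, hy, hyx⟩ := mem_image.1 h
    have h1 := DFunLike.congr_fun hyx j
    have h2 := hmin y hy
    simp [hij] at h1
    omega
  rw [← card_image_of_injective _ (add_left_injective (single j 1)), ← Nat.succ_le_iff,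
    Nat.succ_eq_add_one, ← card_insert_of_notMem hnot]
  refine card_le_card (insert_subset ?_ fun y hy => ?_)
  · obtain ⟨hxA, hxκ⟩ := mem_filter.1 hx
    exact mem_filter.2 ⟨add_single_mem_shadow hxA hi, by
      rw [merge_add, hxκ, merge_single_of_ne hij]⟩
  · obtain ⟨z, hz, rfl⟩ := mem_image.1 hy
    obtain ⟨hzA, hzκ⟩ := mem_filter.1 hz
    exact mem_filter.2 ⟨add_single_mem_shadow hzA hj, by
      rw [merge_add, hzκ, merge_single_self]⟩

theorem shadow_shift_subset {i j : Fin n} (hij : i ≠ j) (hi : i ∈ V) (hj : j ∈ V) :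
    shadow V (shift V d i j A) ⊆ shift V (d + 1) i j (shadow V A) := by
  intro b hb
  obtain ⟨m, hm, k, hk, rfl⟩ := mem_shadow.1 hb
  obtain ⟨hmV, hmlt⟩ := mem_filter.1 hm
  refine mem_filter.2 ⟨add_single_mem_monomialsOn hmV hk 1, ?_⟩
  by_cases hkj : k = j
  · subst hkj
    have := card_fiber_lt_card_fiber_shadow hij hi hj (merge i k m)
      (card_pos.1 (Nat.zero_lt_of_lt hmlt))
    rw [merge_add, merge_single_self]
    simp only [Finsupp.add_apply, single_eq_same]
    omega
  · simp only [Finsupp.add_apply, single_eq_of_ne (Ne.symm hkj), add_zero]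
    refine hmlt.trans_le (card_le_card_of_injOn (· + single k 1) (fun x hx => ?_)
      (add_left_injective _).injOn)
    obtain ⟨hxA, hx⟩ := mem_filter.1 hx
    exact mem_filter.2 ⟨add_single_mem_shadow hxA hk, by rw [merge_add, merge_add, hx]⟩

theorem card_shadow_shift_le {i j : Fin n} (hij : i ≠ j) (hi : i ∈ V) (hj : j ∈ V)
    (hA : A ⊆ monomialsOn V d) : (shadow V (shift V d i j A)).card ≤ (shadow V A).card :=
  (card_le_card (shadow_shift_subset hij hi hj)).trans
    (card_shift hij hi hj (shadow_subset_monomialsOn hA)).le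

theorem sum_range_card_lt {T : Finset ℕ} (hT : T ≠ range T.card) :
    ∑ t ∈ range T.card, t < ∑ t ∈ T, t := by
  set R := range T.card
  have hcard : (T \ R).card = (R \ T).card := by
    have h1 := card_sdiff_add_card_inter T R
    have h2 := card_sdiff_add_card_inter R T
    rw [inter_comm] at h2
    have h3 : R.card = T.card := card_range _
    omega
  have hne : (R \ T).Nonempty := by
    rw [nonempty_iff_ne_empty]
    intro h
    rw [sdiff_eq_empty_iff_subset] at h
    exact hT (eq_of_subset_of_card_le h (card_range _).ge).symm
  have h1 : ∑ t ∈ R \ T, t < (R \ T).card * T.card :=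
    (sum_lt_sum_of_nonempty hne fun t ht => mem_range.1 (mem_sdiff.1 ht).1).trans_eq (by simp)
  have h2 : (T \ R).card * T.card ≤ ∑ t ∈ T \ R, t :=
    card_nsmul_le_sum _ _ _ fun t ht => by
      have := (mem_sdiff.1 ht).2
      simpa [R] using this
  have h3 := sum_inter_add_sum_sdiff T R fun t => t
  have h4 := sum_inter_add_sum_sdiff R T fun t => t
  rw [inter_comm] at h4
  rw [hcard] at h2
  omega

/-- The sum of the indices of the variables dividing a monomial, with multiplicities. -/
noncomputable def indexSum : (Fin n →₀ ℕ) →+ ℕ :=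
  Finsupp.weight fun k : Fin n => (k : ℕ)

theorem indexSum_eq {i j : Fin n} (hij : i < j) (m : Fin n →₀ ℕ) :
    indexSum m = indexSum (merge i j m) + ((j : ℕ) - i) * m j := by
  conv_lhs => rw [← Finsupp.erase_add_single j m]
  have hij' : (i : ℕ) ≤ j := hij.le
  simp only [merge, map_add, indexSum, Finsupp.weight_single, smul_eq_mul]
  rw [add_assoc, mul_comm _ (m j), ← mul_add, Nat.add_sub_cancel' hij']

theorem sum_indexSum_fiber {i j : Fin n} (hij : i < j) (κ : Fin n →₀ ℕ)
    (A : Finset (Fin n →₀ ℕ)) :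
    ∑ m ∈ A with merge i j m = κ, indexSum m =
      (A.filter fun x => merge i j x = κ).card * indexSum κ + ((j : ℕ) - i) *
        ∑ t ∈ (A.filter fun x => merge i j x = κ).image (fun x => x j), t := by
  rw [sum_image (injOn_apply_fiber i j κ A), Finset.mul_sum, ← smul_eq_mul, ← sum_const,
    ← sum_add_distrib]
  refine sum_congr rfl fun m hm => ?_
  rw [indexSum_eq hij, (mem_filter.1 hm).2]

/-- A shift that changes the set lowers its total index. -/
theorem sum_indexSum_shift_lt {i j : Fin n} (hij : i < j) (hi : i ∈ V) (hj : j ∈ V)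
    (hA : A ⊆ monomialsOn V d) (hne : shift V d i j A ≠ A) :
    ∑ m ∈ shift V d i j A, indexSum m < ∑ m ∈ A, indexSum m := by
  have hfib : ∀ B : Finset (Fin n →₀ ℕ), B ⊆ monomialsOn V d → ∑ m ∈ B, indexSum m =
      ∑ κ ∈ (monomialsOn V d).image (merge i j), ∑ m ∈ B with merge i j m = κ, indexSum m :=
    fun B hB => (sum_fiberwise_of_maps_to (fun m hm => mem_image_of_mem _ (hB hm)) _).symm
  have hT : ∀ κ, ((A.filter fun x => merge i j x = κ).image (fun x => x j)).card =
      (A.filter fun x => merge i j x = κ).card := fun κ =>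
    card_image_of_injOn (injOn_apply_fiber i j κ A)
  have hpos : 0 < (j : ℕ) - i := Nat.sub_pos_of_lt hij
  rw [hfib _ (shift_subset i j), hfib _ hA]
  simp only [sum_indexSum_fiber hij, card_fiber_shift hij.ne hi hj hA,
    image_fiber_shift hij.ne hi hj hA]
  have hle : ∀ κ, ∑ t ∈ range (A.filter fun x => merge i j x = κ).card, t ≤
      ∑ t ∈ (A.filter fun x => merge i j x = κ).image (fun x => x j), t := fun κ => by
    by_cases h : (A.filter fun x => merge i j x = κ).image (fun x => x j) =
        range (A.filter fun x => merge i j x = κ).card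
    · rw [h]
    · rw [← hT κ] at h ⊢
      exact (sum_range_card_lt h).le
  refine sum_lt_sum (fun κ _ => Nat.add_le_add_left (Nat.mul_le_mul_left _ (hle κ)) _) ?_
  by_contra hno
  -- otherwise every fibre of `A` is already an initial segment
  refine hne (eq_of_subset_of_card_le (fun m hm => ?_) (card_shift hij.ne hi hj hA).ge)
  obtain ⟨hmV, hmlt⟩ := mem_filter.1 hm
  set κ := merge i j m with hκ
  have hseg : (A.filter fun x => merge i j x = κ).image (fun x => x j) =
      range (A.filter fun x => merge i j x = κ).card := by
    by_contra h
    refine hno ⟨κ, mem_image_of_mem _ hmV,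
      Nat.add_lt_add_left (Nat.mul_lt_mul_of_pos_left ?_ hpos) _⟩
    rw [← hT κ] at h ⊢
    exact sum_range_card_lt h
  have hmem : m j ∈ (A.filter fun x => merge i j x = κ).image (fun x => x j) := by
    rw [hseg]
    exact mem_range.2 hmlt
  obtain ⟨x, hx, hxm⟩ := mem_image.1 hmem
  obtain ⟨hxA, hxκ⟩ := mem_filter.1 hx
  rwa [← eq_of_merge_eq (hxκ.trans hκ) hxm]

/-- Shifting repeatedly, any set of monomials becomes strongly stable without its shadow growing. -/
theorem exists_isStronglyStable (hA : A ⊆ monomialsOn V d) :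
    ∃ B ⊆ monomialsOn V d, B.card = A.card ∧ (shadow V B).card ≤ (shadow V A).card ∧
      IsStronglyStable V B := by
  obtain ⟨B, hB, hmin⟩ := exists_min_image
    ((monomialsOn V d).powerset.filter fun B =>
      B.card = A.card ∧ (shadow V B).card ≤ (shadow V A).card)
    (fun B => ∑ m ∈ B, indexSum m) ⟨A, by simpa using hA⟩
  obtain ⟨hBV, hcard, hsh⟩ := mem_filter.1 hB
  rw [mem_powerset] at hBV
  refine ⟨B, hBV, hcard, hsh, fun m i hi j hj hij hm => ?_⟩
  have hfix : shift V d i j B = B := by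
    by_contra hne
    refine absurd (hmin (shift V d i j B) ?_)
      (not_le.2 (sum_indexSum_shift_lt hij hi hj hBV hne))
    exact mem_filter.2 ⟨mem_powerset.2 (shift_subset i j),
      (card_shift hij.ne hi hj hBV).trans hcard,
      (card_shadow_shift_le hij.ne hi hj hBV).trans hsh⟩
  rw [← hfix] at hm ⊢
  obtain ⟨hmV, hlt⟩ := mem_filter.1 hm
  obtain ⟨hd, hs⟩ := mem_monomialsOn.1 hmV
  refine mem_filter.2 ⟨mem_monomialsOn.2 ⟨by simpa using hd, fun q hq => ?_⟩, ?_⟩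
  · have h1 : i ≠ q := by rintro rfl; exact hq hi
    have h2 := hs q hq
    simp only [Finsupp.add_apply, Nat.add_eq_zero_iff] at h2
    simp [h1, h2.1]
  · rw [merge_add, merge_single_self] at hlt
    rw [merge_add, merge_single_of_ne hij.ne]
    simp only [Finsupp.add_apply, single_eq_same, single_eq_of_ne hij.ne'] at hlt ⊢
    omega

/-- **Macaulay's theorem**: among the sets of at least `k` monomials of degree `d`, the
lexicographic set with `k` elements has the smallest shadow. -/
theorem IsLexSet.card_shadow_le (hL : IsLexSet V d L) (hA : A ⊆ monomialsOn V d)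
    (h : L.card ≤ A.card) : (shadow V L).card ≤ (shadow V A).card := by
  obtain ⟨B, hBV, hcard, hsh, hB⟩ := exists_isStronglyStable hA
  exact (hB.card_shadow_le V hBV hL (h.trans hcard.ge)).trans hsh

end Combinatorics

variable {n : ℕ} {𝕜 : Type*} [Field 𝕜]

/-! ### Initial monomials -/

/-- The exponents of the initial monomials of the nonzero elements of `I`. -/
def initialExponents (m : MonomialOrder (Fin n)) (I : Ideal (MvPolynomial (Fin n) 𝕜)) :
    Set (Fin n →₀ ℕ) :=
  {a | ∃ f ∈ I, f ≠ 0 ∧ m.degree f = a}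

open scoped Classical in
/-- The exponents of degree `d` of the initial monomials of `I`. -/
noncomputable def initialSet (m : MonomialOrder (Fin n)) (I : Ideal (MvPolynomial (Fin n) 𝕜))
    (d : ℕ) : Finset (Fin n →₀ ℕ) :=
  (monomialsOn Finset.univ d).filter fun a => a ∈ initialExponents m I

variable {m : MonomialOrder (Fin n)} {I J : Ideal (MvPolynomial (Fin n) 𝕜)}

theorem mem_monomialsOn_univ {d : ℕ} {a : Fin n →₀ ℕ} :
    a ∈ monomialsOn Finset.univ d ↔ a.degree = d := by
  rw [mem_monomialsOn]
  simp

theorem mem_initialSet {d : ℕ} {a : Fin n →₀ ℕ} :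
    a ∈ initialSet m I d ↔ a.degree = d ∧ a ∈ initialExponents m I := by
  simp only [initialSet, Finset.mem_filter, mem_monomialsOn_univ]

theorem initialSet_subset (d : ℕ) : initialSet m I d ⊆ monomialsOn Finset.univ d := fun _ ha =>
  mem_monomialsOn_univ.2 (mem_initialSet.1 ha).1

theorem degree_mem_initialExponents {f : MvPolynomial (Fin n) 𝕜} (hf : f ∈ I) (h0 : f ≠ 0) :
    m.degree f ∈ initialExponents m I :=
  ⟨f, hf, h0, rfl⟩

theorem mem_initialExponents_of_le {a b : Fin n →₀ ℕ} (ha : a ∈ initialExponents m I)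
    (hab : a ≤ b) : b ∈ initialExponents m I := by
  classical
  obtain ⟨f, hf, h0, rfl⟩ := ha
  have h1 : monomial (b - m.degree f) (1 : 𝕜) ≠ 0 := by simp
  refine ⟨monomial (b - m.degree f) 1 * f, I.mul_mem_left _ hf, mul_ne_zero h1 h0, ?_⟩
  rw [m.degree_mul h1 h0, m.degree_monomial, if_neg one_ne_zero, tsub_add_cancel_of_le hab]

theorem shadow_initialSet_subset (d : ℕ) :
    shadow Finset.univ (initialSet m I d) ⊆ initialSet m I (d + 1) := by
  intro b hb
  obtain ⟨a, ha, i, -, rfl⟩ := mem_shadow.1 hb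
  rw [mem_initialSet] at ha ⊢
  exact ⟨by simp [ha.1], mem_initialExponents_of_le ha.2 le_self_add⟩

/-! ### Normal forms modulo an ideal -/

theorem eq_zero_of_mem_of_support {f : MvPolynomial (Fin n) 𝕜} (hf : f ∈ I)
    (h : ∀ c ∈ f.support, c ∉ initialExponents m I) : f = 0 := by
  by_contra h0
  exact h _ (m.degree_mem_support h0) (degree_mem_initialExponents hf h0)

theorem exists_normalForm (m : MonomialOrder (Fin n)) (I : Ideal (MvPolynomial (Fin n) 𝕜))
    (f : MvPolynomial (Fin n) 𝕜) :
    ∃ r, f - r ∈ I ∧ ∀ c ∈ r.support, c ∉ initialExponents m I := by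
  obtain ⟨q, r, hfr, -, hr⟩ := m.div_set (B := {g | g ∈ I ∧ g ≠ 0})
    (fun g hg => (m.leadingCoeff_ne_zero_iff.2 hg.2).isUnit) f
  refine ⟨r, ?_, fun c hc => ?_⟩
  · rw [hfr, add_sub_cancel_right, Finsupp.linearCombination_apply]
    exact Ideal.sum_mem _ fun g _ => I.mul_mem_left _ g.2.1
  · rintro ⟨g, hg, h0, rfl⟩
    exact hr _ hc g ⟨hg, h0⟩ le_rfl

/-! ### Hilbert series and initial monomials -/

theorem homogeneousComponent_mem (hI : IsHomogeneousIdeal I) {f : MvPolynomial (Fin n) 𝕜}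
    (hf : f ∈ I) (d : ℕ) : homogeneousComponent d f ∈ I :=
  homogeneousComponent_mem_of_mem hI hf d

/-- The monomials of degree `d` that are not initial monomials of `I` form a basis of `(S/I)_d`. -/
theorem finrank_quotientComponent_add_card (m : MonomialOrder (Fin n)) (hI : IsHomogeneousIdeal I)
    (d : ℕ) : Module.finrank 𝕜 (quotientComponent I d) + (initialSet m I d).card =
      (monomialsOn (Finset.univ : Finset (Fin n)) d).card := by
  classical
  set S := monomialsOn (Finset.univ : Finset (Fin n)) d \ initialSet m I d
  have hS : ∀ {a}, a ∈ S ↔ a.degree = d ∧ a ∉ initialExponents m I := fun {a} => by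
    rw [Finset.mem_sdiff, mem_monomialsOn_univ, mem_initialSet]
    tauto
  let v : S → MvPolynomial (Fin n) 𝕜 ⧸ I := fun a => Ideal.Quotient.mkₐ 𝕜 I (monomial a.1 1)
  have hli : LinearIndependent 𝕜 v := by
    rw [Fintype.linearIndependent_iff]
    intro g hg
    set f : MvPolynomial (Fin n) 𝕜 := ∑ a : S, g a • monomial a.1 1 with hf
    have hcoeff : ∀ c, f.coeff c = ∑ a : S, if a.1 = c then g a else 0 := fun c => by
      rw [hf, coeff_sum]
      refine Finset.sum_congr rfl fun a _ => ?_
      rw [coeff_smul, coeff_monomial, smul_eq_mul, mul_ite, mul_one, mul_zero]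
    have hfI : f ∈ I := by
      rw [← Ideal.Quotient.eq_zero_iff_mem, ← Ideal.Quotient.mkₐ_eq_mk 𝕜, hf, map_sum]
      simpa [v] using hg
    have hf0 : f = 0 := by
      refine eq_zero_of_mem_of_support (m := m) hfI fun c hc => ?_
      by_contra hcE
      refine mem_support_iff.1 hc ?_
      rw [hcoeff]
      refine Finset.sum_eq_zero fun a _ => if_neg ?_
      rintro rfl
      exact (hS.1 a.2).2 hcE
    intro a
    have := hcoeff a.1
    rw [hf0, coeff_zero, Finset.sum_eq_single a (fun b _ hb => if_neg (fun h => hb (Subtype.ext h)))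
      (fun h => absurd (Finset.mem_univ a) h), if_pos rfl] at this
    exact this.symm
  have hspan : quotientComponent I d = Submodule.span 𝕜 (Set.range v) := by
    refine le_antisymm ?_ (Submodule.span_le.2 ?_)
    · rintro _ ⟨p, hp, rfl⟩
      obtain ⟨r, hr, hrE⟩ := exists_normalForm m I p
      set r' := homogeneousComponent d r with hr'
      have hpr : p - r' ∈ I := by
        have := homogeneousComponent_mem hI hr d
        rwa [map_sub, homogeneousComponent_eq_self ((mem_homogeneousSubmodule d p).1 hp)] at this
      have heq : (Ideal.Quotient.mkₐ 𝕜 I).toLinearMap p = Ideal.Quotient.mkₐ 𝕜 I r' :=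
        Ideal.Quotient.eq.2 hpr
      rw [heq, r'.as_sum, map_sum]
      refine Submodule.sum_mem _ fun c hc => ?_
      rw [hr', support_homogeneousComponent, Finset.mem_filter] at hc
      have : monomial c (r'.coeff c) = r'.coeff c • monomial c (1 : 𝕜) := by
        rw [smul_monomial, smul_eq_mul, mul_one]
      rw [this, map_smul]
      exact Submodule.smul_mem _ _ (Submodule.subset_span ⟨⟨c, hS.2 ⟨hc.2, hrE c hc.1⟩⟩, rfl⟩)
    · rintro _ ⟨a, rfl⟩
      exact ⟨monomial a.1 1, isHomogeneous_monomial 1 (hS.1 a.2).1, rfl⟩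
  rw [hspan, finrank_span_eq_card hli, Fintype.card_coe,
    Finset.card_sdiff_add_card_eq_card (initialSet_subset d)]

theorem hilbertSeries_eq_iff (m m' : MonomialOrder (Fin n)) (hI : IsHomogeneousIdeal I)
    (hJ : IsHomogeneousIdeal J) : hilbertSeries J = hilbertSeries I ↔
      ∀ d, (initialSet m' J d).card = (initialSet m I d).card := by
  rw [PowerSeries.ext_iff]
  refine forall_congr' fun d => ?_
  rw [hilbertSeries, hilbertSeries, PowerSeries.coeff_mk, PowerSeries.coeff_mk, Nat.cast_inj]
  have h1 := finrank_quotientComponent_add_card m hI d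
  have h2 := finrank_quotientComponent_add_card m' hJ d
  omega

/-! ### Monomial ideals and lexsegment ideals -/

theorem monomial_mem_span_iff {A : Set (Fin n →₀ ℕ)} {c : Fin n →₀ ℕ} :
    monomial c (1 : 𝕜) ∈ Ideal.span ((fun a => monomial a (1 : 𝕜)) '' A) ↔ ∃ a ∈ A, a ≤ c := by
  classical
  rw [mem_ideal_span_monomial_image, support_monomial, if_neg one_ne_zero]
  simp

namespace IsMonomialIdeal

theorem mem_iff (hJ : IsMonomialIdeal J) {f : MvPolynomial (Fin n) 𝕜} :
    f ∈ J ↔ ∀ c ∈ f.support, monomial c (1 : 𝕜) ∈ J := by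
  obtain ⟨A, rfl⟩ := hJ
  rw [mem_ideal_span_monomial_image]
  exact forall₂_congr fun c _ => monomial_mem_span_iff.symm

theorem isHomogeneousIdeal (hJ : IsMonomialIdeal J) : IsHomogeneousIdeal J := by
  obtain ⟨A, rfl⟩ := hJ
  let : GradedAlgebra (homogeneousSubmodule (Fin n) 𝕜) := MvPolynomial.gradedAlgebra
  refine Ideal.homogeneous_span _ _ ?_
  rintro _ ⟨a, -, rfl⟩
  exact ⟨a.degree, isHomogeneous_monomial 1 rfl⟩

theorem mem_initialExponents (hJ : IsMonomialIdeal J) (m : MonomialOrder (Fin n))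
    {a : Fin n →₀ ℕ} : a ∈ initialExponents m J ↔ monomial a (1 : 𝕜) ∈ J := by
  classical
  constructor
  · rintro ⟨f, hf, h0, rfl⟩
    exact hJ.mem_iff.1 hf _ (m.degree_mem_support h0)
  · intro ha
    refine ⟨_, ha, by simp, ?_⟩
    rw [m.degree_monomial, if_neg one_ne_zero]

theorem ext (hI : IsMonomialIdeal I) (hJ : IsMonomialIdeal J)
    (h : ∀ a, monomial a (1 : 𝕜) ∈ I ↔ monomial a (1 : 𝕜) ∈ J) : I = J := by
  ext f
  rw [hI.mem_iff, hJ.mem_iff]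
  exact forall₂_congr fun c _ => h c

end IsMonomialIdeal

theorem IsLexsegment.isLexSet_initialSet (hJ : IsLexsegment J) (d : ℕ) :
    IsLexSet Finset.univ d (initialSet MonomialOrder.lex J d) := by
  refine ⟨initialSet_subset d, fun a ha b hb hab => ?_⟩
  rw [mem_monomialsOn_univ] at hb
  rw [mem_initialSet, hJ.1.mem_initialExponents] at ha ⊢
  exact ⟨hb, hJ.2 a b ha.2 (ha.1.trans hb.symm) (MonomialOrder.lex_le_iff.2 hab)⟩

/-- Lexsegment ideals with the same Hilbert series have the same number of monomials in each degree,
so they coincide. -/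
theorem IsLexsegment.eq_of_hilbertSeries_eq (hI : IsLexsegment I) (hJ : IsLexsegment J)
    (h : hilbertSeries J = hilbertSeries I) : J = I := by
  rw [hilbertSeries_eq_iff MonomialOrder.lex MonomialOrder.lex hI.1.isHomogeneousIdeal
    hJ.1.isHomogeneousIdeal] at h
  refine hJ.1.ext hI.1 fun a => ?_
  have heq : initialSet MonomialOrder.lex J a.degree = initialSet MonomialOrder.lex I a.degree :=
    Finset.Subset.antisymm
      ((hJ.isLexSet_initialSet _).subset_of_card_le (hI.isLexSet_initialSet _) (h _).le)
      ((hI.isLexSet_initialSet _).subset_of_card_le (hJ.isLexSet_initialSet _) (h _).ge)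
  have := Finset.ext_iff.1 heq a
  simpa [mem_initialSet, hI.1.mem_initialExponents, hJ.1.mem_initialExponents] using this

theorem add_mem_of_shadow_subset {L : ℕ → Finset (Fin n →₀ ℕ)}
    (hL : ∀ d, shadow Finset.univ (L d) ⊆ L (d + 1)) (c : Fin n →₀ ℕ) :
    ∀ d, ∀ a ∈ L d, a + c ∈ L (d + c.degree) := by
  induction c using Finsupp.induction_linear with
  | zero => simp
  | add f g hf hg =>
    intro d a ha
    rw [← add_assoc, map_add, ← add_assoc]
    exact hg _ _ (hf _ _ ha)
  | single i k =>
    intro d a ha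
    rw [Finsupp.degree_single]
    induction k with
    | zero => simpa using ha
    | succ k ih =>
      rw [Finsupp.single_add, ← add_assoc, ← add_assoc]
      exact hL _ (add_single_mem_shadow ih (Finset.mem_univ i))

/-- The lexicographic sets with as many elements as `I` has initial monomials are, by Macaulay's
theorem, the graded pieces of an ideal. -/
theorem exists_isLexsegmentIdealOf (hI : IsHomogeneousIdeal I) :
    ∃ J : Ideal (MvPolynomial (Fin n) 𝕜), IsLexsegmentIdealOf J I := by
  choose L hL hcard using fun d => exists_isLexSet_card Finset.univ d
    (Finset.card_le_card (initialSet_subset (m := MonomialOrder.lex) (I := I) d))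
  have hshadow : ∀ d, shadow Finset.univ (L d) ⊆ L (d + 1) := fun d => by
    refine (hL d).shadow.subset_of_card_le (hL (d + 1)) ?_
    refine ((hL d).card_shadow_le (initialSet_subset d) (hcard d).le).trans ?_
    rw [hcard]
    exact Finset.card_le_card (shadow_initialSet_subset d)
  have hdeg : ∀ {d a}, a ∈ L d → a.degree = d := fun ha => mem_monomialsOn_univ.1 ((hL _).1 ha)
  set J : Ideal (MvPolynomial (Fin n) 𝕜) :=
    Ideal.span ((fun a => monomial a (1 : 𝕜)) '' {a | a ∈ L a.degree}) with hJdef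
  have hJ : IsMonomialIdeal J := ⟨_, rfl⟩
  have hmem : ∀ b, monomial b (1 : 𝕜) ∈ J ↔ b ∈ L b.degree := fun b => by
    rw [hJdef, monomial_mem_span_iff]
    refine ⟨?_, fun hb => ⟨b, hb, le_rfl⟩⟩
    rintro ⟨a, ha, hab⟩
    obtain ⟨c, rfl⟩ := exists_add_of_le hab
    rw [map_add]
    exact add_mem_of_shadow_subset hshadow c _ a ha
  have hset : ∀ d, initialSet MonomialOrder.lex J d = L d := fun d => by
    ext a
    rw [mem_initialSet, hJ.mem_initialExponents, hmem]
    constructor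
    · rintro ⟨rfl, ha⟩
      exact ha
    · exact fun ha => ⟨hdeg ha, (hdeg ha).symm ▸ ha⟩
  refine ⟨J, ⟨hJ, fun a b ha hab hle => ?_⟩, ?_⟩
  · rw [hmem] at ha ⊢
    rw [hab] at ha
    exact (hL _).2 a ha b (mem_monomialsOn_univ.2 rfl) (MonomialOrder.lex_le_iff.1 hle)
  · rw [hilbertSeries_eq_iff MonomialOrder.lex MonomialOrder.lex hI hJ.isHomogeneousIdeal]
    exact fun d => by rw [hset, hcard]

/-! ### Reduced Gröbner bases -/

/-- `g` is an element of `I` of the form `xᵃ - r`, where no initial monomial of `I` occurs in `r` and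
`r` has no term `xᵃ`. -/
def IsReducedElement (m : MonomialOrder (Fin n)) (I : Ideal (MvPolynomial (Fin n) 𝕜))
    (a : Fin n →₀ ℕ) (g : MvPolynomial (Fin n) 𝕜) : Prop :=
  g ∈ I ∧ g.coeff a = 1 ∧ ∀ c ∈ g.support, c ≠ a → c ∉ initialExponents m I

theorem exists_isReducedElement {a : Fin n →₀ ℕ} (ha : a ∈ initialExponents m I) :
    ∃ g, IsReducedElement m I a g := by
  classical
  obtain ⟨r, hr, hrE⟩ := exists_normalForm m I (monomial a 1)
  have hra : r.coeff a = 0 := by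
    by_contra h
    exact hrE a (mem_support_iff.2 h) ha
  refine ⟨_, hr, by simp [hra], fun c hc hca => hrE c (mem_support_iff.2 ?_)⟩
  have := mem_support_iff.1 hc
  rwa [coeff_sub, coeff_monomial, if_neg hca.symm, zero_sub, neg_ne_zero] at this

namespace IsReducedElement

variable {a : Fin n →₀ ℕ} {g h : MvPolynomial (Fin n) 𝕜}

theorem unique (hg : IsReducedElement m I a g) (hh : IsReducedElement m I a h) : g = h := by
  refine sub_eq_zero.1 (eq_zero_of_mem_of_support (m := m) (I.sub_mem hg.1 hh.1) fun c hc => ?_)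
  rw [mem_support_iff, coeff_sub] at hc
  have hca : c ≠ a := by
    rintro rfl
    rw [hg.2.1, hh.2.1, sub_self] at hc
    exact hc rfl
  by_cases hgc : g.coeff c = 0
  · rw [hgc, zero_sub, neg_ne_zero] at hc
    exact hh.2.2 c (mem_support_iff.2 hc) hca
  · exact hg.2.2 c (mem_support_iff.2 hgc) hca

theorem ne_zero (hg : IsReducedElement m I a g) : g ≠ 0 := by
  rintro rfl
  simpa using hg.2.1

theorem degree_eq (hg : IsReducedElement m I a g) : m.degree g = a := by
  by_contra hne
  exact hg.2.2 _ (m.degree_mem_support hg.ne_zero) hne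
    (degree_mem_initialExponents hg.1 hg.ne_zero)

theorem monic (hg : IsReducedElement m I a g) : m.Monic g := by
  rw [MonomialOrder.Monic, MonomialOrder.leadingCoeff, hg.degree_eq, hg.2.1]

/-- In a homogeneous ideal, the component of degree `a.degree` of a reduced element is reduced too,
hence equal to it. -/
theorem totalDegree_eq (hI : IsHomogeneousIdeal I) (hg : IsReducedElement m I a g) :
    g.totalDegree = a.degree := by
  have hcomp : IsReducedElement m I a (homogeneousComponent a.degree g) := by
    refine ⟨homogeneousComponent_mem hI hg.1 _, ?_, fun c hc => hg.2.2 c ?_⟩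
    · rw [coeff_homogeneousComponent, if_pos rfl, hg.2.1]
    · rw [support_homogeneousComponent, Finset.mem_filter] at hc
      exact hc.1
  have hhom := homogeneousComponent_isHomogeneous a.degree g
  rw [← hg.unique hcomp] at hhom
  exact hhom.totalDegree hg.ne_zero

end IsReducedElement

theorem initialIdeal_eq_span (m : MonomialOrder (Fin n)) (I : Ideal (MvPolynomial (Fin n) 𝕜)) :
    initialIdeal m I =
      Ideal.span ((fun a => monomial a (1 : 𝕜)) '' initialExponents m I) := by
  rw [initialIdeal, m.span_leadingTerm_eq_span_monomial']
  congr 1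
  ext p
  constructor
  · rintro ⟨f, ⟨hf, h0⟩, rfl⟩
    exact ⟨_, degree_mem_initialExponents hf h0, rfl⟩
  · rintro ⟨_, ⟨f, hf, h0, rfl⟩, rfl⟩
    exact ⟨f, ⟨hf, h0⟩, rfl⟩

theorem isGroebnerBasis_iff {G : Finset (MvPolynomial (Fin n) 𝕜)} (hG : ∀ g ∈ G, g ∈ I)
    (h0 : ∀ g ∈ G, g ≠ 0) : IsGroebnerBasis m I G ↔
      ∀ a ∈ initialExponents m I, ∃ g ∈ G, m.degree g ≤ a := by
  have hspan : Ideal.span (m.leadingTerm '' (G : Set (MvPolynomial (Fin n) 𝕜))) =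
      Ideal.span ((fun a => monomial a (1 : 𝕜)) ''
        (m.degree '' (G : Set (MvPolynomial (Fin n) 𝕜)))) := by
    rw [m.span_leadingTerm_eq_span_monomial fun g hg =>
      (m.leadingCoeff_ne_zero_iff.2 (h0 g hg)).isUnit, Set.image_image]
  rw [IsGroebnerBasis, and_iff_right hG, hspan, initialIdeal_eq_span]
  constructor
  · intro h a ha
    have : monomial a (1 : 𝕜) ∈
        Ideal.span ((fun a => monomial a (1 : 𝕜)) '' initialExponents m I) :=
      Ideal.subset_span ⟨a, ha, rfl⟩
    rw [h, monomial_mem_span_iff] at this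
    simpa using this
  · intro h
    ext f
    simp only [mem_ideal_span_monomial_image]
    refine forall₂_congr fun c _ => ⟨?_, ?_⟩
    · rintro ⟨a, ha, hac⟩
      obtain ⟨g, hg, hga⟩ := h a ha
      exact ⟨_, ⟨g, hg, rfl⟩, hga.trans hac⟩
    · rintro ⟨_, ⟨g, hg, rfl⟩, hgc⟩
      exact ⟨_, degree_mem_initialExponents (hG g hg) (h0 g hg), hgc⟩

theorem exists_minimal_le {a : Fin n →₀ ℕ} (ha : a ∈ initialExponents m I) :
    ∃ b ≤ a, Minimal (· ∈ initialExponents m I) b :=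
  exists_minimal_le_of_wellFoundedLT (· ∈ initialExponents m I) a ha

/-- The reduced Gröbner basis consists of the reduced elements attached to the minimal initial
monomials. -/
theorem isReducedGroebnerBasis_iff {G : Finset (MvPolynomial (Fin n) 𝕜)} :
    IsReducedGroebnerBasis m I G ↔ ∀ g, g ∈ G ↔
      ∃ a, Minimal (· ∈ initialExponents m I) a ∧ IsReducedElement m I a g := by
  constructor
  · rintro ⟨hGB, hmonic, hred⟩
    have h0 : ∀ g ∈ G, g ≠ 0 := fun g hg => (hmonic g hg).ne_zero
    have hdiv := (isGroebnerBasis_iff hGB.1 h0).1 hGB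
    have hforward : ∀ g ∈ G, Minimal (· ∈ initialExponents m I) (m.degree g) ∧
        IsReducedElement m I (m.degree g) g := by
      intro g hg
      refine ⟨⟨degree_mem_initialExponents (hGB.1 g hg) (h0 g hg), fun b hb hbg => ?_⟩,
        hGB.1 g hg, (hmonic g hg).coeff_degree, fun c hc hcg hcE => ?_⟩
      · obtain ⟨h, hh, hhb⟩ := hdiv b hb
        by_cases hhg : h = g
        · exact hhg ▸ hhb
        · exact absurd (hhb.trans hbg)
            (hred g hg h hh hhg _ (m.degree_mem_support (h0 g hg)))
      · obtain ⟨h, hh, hhc⟩ := hdiv c hcE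
        by_cases hhg : h = g
        · subst hhg
          exact hcg (m.toSyn.injective (le_antisymm (m.le_degree hc) (m.toSyn_monotone hhc)))
        · exact hred g hg h hh hhg c hc hhc
    refine fun g => ⟨fun hg => ⟨_, hforward g hg⟩, ?_⟩
    rintro ⟨a, ha, hga⟩
    obtain ⟨h, hh, hha⟩ := hdiv a ha.1
    have hda : m.degree h = a :=
      ha.eq_of_le (degree_mem_initialExponents (hGB.1 h hh) (h0 h hh)) hha
    rw [hga.unique (hda ▸ (hforward h hh).2)]
    exact hh
  · intro hG
    have hGI : ∀ g ∈ G, g ∈ I := fun g hg => by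
      obtain ⟨a, -, hga⟩ := (hG g).1 hg
      exact hga.1
    have h0 : ∀ g ∈ G, g ≠ 0 := fun g hg => by
      obtain ⟨a, -, hga⟩ := (hG g).1 hg
      exact hga.ne_zero
    refine ⟨(isGroebnerBasis_iff hGI h0).2 fun a ha => ?_, fun g hg => ?_,
      fun g hg h hh hhg c hc hle => ?_⟩
    · obtain ⟨b, hba, hb⟩ := exists_minimal_le ha
      obtain ⟨g, hg⟩ := exists_isReducedElement hb.1
      exact ⟨g, (hG g).2 ⟨b, hb, hg⟩, hg.degree_eq.le.trans hba⟩
    · obtain ⟨a, -, hga⟩ := (hG g).1 hg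
      exact hga.monic
    · obtain ⟨a, ha, hga⟩ := (hG g).1 hg
      obtain ⟨b, hb, hhb⟩ := (hG h).1 hh
      rw [hhb.degree_eq] at hle
      by_cases hca : c = a
      · have hba : b = a := ha.eq_of_le hb.1 (hca ▸ hle)
        exact hhg (hhb.unique (hba ▸ hga))
      · exact hga.2.2 c hc hca (mem_initialExponents_of_le hb.1 hle)

theorem existsUnique_isReducedGroebnerBasis (m : MonomialOrder (Fin n))
    (I : Ideal (MvPolynomial (Fin n) 𝕜)) :
    ∃! G : Finset (MvPolynomial (Fin n) 𝕜), IsReducedGroebnerBasis m I G := by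
  classical
  have hfin : {a | Minimal (· ∈ initialExponents m I) a}.Finite :=
    WellQuasiOrderedLE.finite_of_isAntichain (setOfPred_minimal_antichain _)
  choose! r hr using fun a (ha : a ∈ initialExponents m I) => exists_isReducedElement ha
  refine ⟨hfin.toFinset.image r, isReducedGroebnerBasis_iff.2 fun g => ?_, fun G hG => ?_⟩
  · simp only [Finset.mem_image, Set.Finite.mem_toFinset, Set.mem_ofPred_eq]
    constructor
    · rintro ⟨a, ha, rfl⟩
      exact ⟨a, ha, hr a ha.1⟩
    · rintro ⟨a, ha, hga⟩
      exact ⟨a, ha, (hr a ha.1).unique hga⟩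
  · ext g
    rw [isReducedGroebnerBasis_iff.1 hG g]
    simp only [Finset.mem_image, Set.Finite.mem_toFinset, Set.mem_ofPred_eq]
    constructor
    · rintro ⟨a, ha, hga⟩
      exact ⟨a, ha, (hr a ha.1).unique hga⟩
    · rintro ⟨a, ha, rfl⟩
      exact ⟨a, ha, hr a ha.1⟩

/-! ### Degrees of generators -/

/-- A monomial of degree `d + 1` in a monomial ideal is a minimal generator if it is not in the
shadow of the monomials of degree `d`. -/
theorem IsMonomialIdeal.mem_minimalGenerators (hJ : IsMonomialIdeal J) {d : ℕ} {b : Fin n →₀ ℕ}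
    (hb : b ∈ initialSet m J (d + 1)) (hb' : b ∉ shadow Finset.univ (initialSet m J d)) :
    b ∈ minimalGenerators J := by
  obtain ⟨hbd, hbJ⟩ := mem_initialSet.1 hb
  refine ⟨(hJ.mem_initialExponents m).1 hbJ, fun c hc hcb => ?_⟩
  by_contra hbc
  obtain ⟨i, hi⟩ : ∃ i, c i < b i := by
    by_contra hno
    push Not at hno
    exact hbc hno
  obtain ⟨e, rfl⟩ : ∃ e, b = e + Finsupp.single i 1 :=
    ⟨b - Finsupp.single i 1, (tsub_add_cancel_of_le (by simp; omega)).symm⟩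
  have hce : c ≤ e := fun q => by
    by_cases hq : q = i
    · subst hq
      simpa [Nat.lt_succ_iff] using hi
    · simpa [hq] using hcb q
  refine hb' (add_single_mem_shadow (mem_initialSet.2 ⟨by simpa using hbd, ?_⟩)
    (Finset.mem_univ i))
  exact mem_initialExponents_of_le ((hJ.mem_initialExponents m).2 hc) hce

/-- In each degree the lexsegment ideal has at least as many minimal generators as the initial
ideal, because the shadow of its part of lower degree is the smaller one. -/
theorem degree_le_maxdeg (hI : IsHomogeneousIdeal I) (hJ : IsLexsegmentIdealOf J I)
    {a : Fin n →₀ ℕ} (ha : Minimal (· ∈ initialExponents m I) a) : a.degree ≤ maxdeg J := by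
  obtain ⟨hJlex, hHS⟩ := hJ
  have hcard := (hilbertSeries_eq_iff m MonomialOrder.lex hI hJlex.1.isHomogeneousIdeal).1 hHS
  rcases hd : a.degree with _ | d
  · exact Nat.zero_le _
  have hnot : a ∉ shadow Finset.univ (initialSet m I d) := by
    intro h
    obtain ⟨e, he, i, -, rfl⟩ := mem_shadow.1 h
    have h1 : e = e + Finsupp.single i 1 := ha.eq_of_le (mem_initialSet.1 he).2 le_self_add
    have h2 := DFunLike.congr_fun h1 i
    simp at h2
  have hlt : (shadow Finset.univ (initialSet MonomialOrder.lex J d)).card <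
      (initialSet MonomialOrder.lex J (d + 1)).card := by
    rw [hcard (d + 1)]
    refine ((hJlex.isLexSet_initialSet d).card_shadow_le (initialSet_subset d)
      (hcard d).le).trans_lt ?_
    exact Finset.card_lt_card ((Finset.ssubset_iff_of_subset (shadow_initialSet_subset d)).2
      ⟨a, mem_initialSet.2 ⟨hd, ha.1⟩, hnot⟩)
  obtain ⟨b, hb, hb'⟩ := Finset.exists_mem_notMem_of_card_lt_card hlt
  rw [← (mem_initialSet.1 hb).1]
  exact Finset.le_sup (f := fun a : Fin n →₀ ℕ => a.degree)
    ((minimalGenerators_finite J).mem_toFinset.2 (hJlex.1.mem_minimalGenerators hb hb'))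

end LexSeg

theorem corollary3p3 {𝕜 : Type*} [Field 𝕜] {n : ℕ} (I : Ideal (MvPolynomial (Fin n) 𝕜))
    (hI : LexSeg.IsHomogeneousIdeal I) :
    (∃! J : Ideal (MvPolynomial (Fin n) 𝕜), LexSeg.IsLexsegmentIdealOf J I) ∧
    ∀ J : Ideal (MvPolynomial (Fin n) 𝕜), LexSeg.IsLexsegmentIdealOf J I →
      ∀ m : MonomialOrder (Fin n),
        (∃! G : Finset (MvPolynomial (Fin n) 𝕜), LexSeg.IsReducedGroebnerBasis m I G) ∧
        ∀ G : Finset (MvPolynomial (Fin n) 𝕜), LexSeg.IsReducedGroebnerBasis m I G →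
          LexSeg.maxTotalDegree G ≤ LexSeg.maxdeg J := by
  refine ⟨?_, fun J hJ m =>
    ⟨LexSeg.existsUnique_isReducedGroebnerBasis m I, fun G hG => Finset.sup_le fun g hg => ?_⟩⟩
  · obtain ⟨J, hJ⟩ := LexSeg.exists_isLexsegmentIdealOf hI
    exact ⟨J, hJ, fun J' hJ' => hJ.1.eq_of_hilbertSeries_eq hJ'.1 (hJ'.2.trans hJ.2.symm)⟩
  · obtain ⟨a, ha, hga⟩ := (LexSeg.isReducedGroebnerBasis_iff.1 hG g).1 hg
    rw [hga.totalDegree_eq hI]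
    exact LexSeg.degree_le_maxdeg hI hJ ha
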